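/- Proposition. A binary $[n,k,d]$ code is a $k$-dimensional subspace $C$ of $\mathbb{F}_2^n$ whose minimum weight, i.e. the least number of nonzero coordinates of a nonzero vector of $C$, is exactly $d$. It is called LCD (linear complementary dual) if $C \cap C^\perp = \{\mathbf{0}\}$, where $C^\perp=\{x\in\mathbb{F}_2^n \mid x\cdot y=0 \text{ for all } y\in C\}$ for the standard inner product. Two codes $C, C'$ of length $n$ are equivalent if $C' = \{xP \mid x\in C\}$ for some $n\times n$ monomial matrix $P$ over $\mathbb{F}_2$ (equivalently, a permutation matrix). Let $N(n,k,d)$ be the number of equivalence classes of binary LCD $[n,k,d]$ codes. A $k$-cover of a set $X$ with $m$ elements is a sequence $(Y_1,\dots,Y_k)$ of $k$ not necessarily distinct (possibly empty) subsets of $X$ whose union is $X$. Let $T_{du}(m,k)$ be the number of disordered $k$-covers of an unlabelled $m$-set, i.e. the number of classes of $k$-covers of $X$ when two covers are identified if one is obtained from the other by a permutation of the $k$ sets together with a permutation of the elements of $X$. If $1 \le m \le 11$, then $$N(2m+3,2m,2) = N(2m+4,2m+1,2) = T_{du}(m,3).$$ -/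

import Mathlib

open scoped Matrix

/-- A binary linear code of length `n`: a vector subspace of `𝔽₂ⁿ`. -/
abbrev BinaryCode (n : ℕ) : Type := Submodule (ZMod 2) (Fin n → ZMod 2)

namespace BinaryCode

/-- The dual code, with respect to the standard inner product. -/
def dual {n : ℕ} (C : BinaryCode n) : BinaryCode n where
  carrier := {x | ∀ y ∈ C, x ⬝ᵥ y = 0}
  zero_mem' := fun y _ => zero_dotProduct y
  add_mem' := fun {a b} ha hb y hy => by
    rw [add_dotProduct, ha y hy, hb y hy, add_zero]
  smul_mem' := fun c x hx y hy => by
    rw [smul_dotProduct, hx y hy, smul_zero]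

/-- A code is linear complementary dual if it meets its dual code only in the zero vector. -/
def IsLCD {n : ℕ} (C : BinaryCode n) : Prop := C ⊓ C.dual = ⊥

/-- `d` is the minimum weight of `C`: the least weight of a nonzero codeword. -/
def HasMinWeight {n : ℕ} (C : BinaryCode n) (d : ℕ) : Prop :=
  IsLeast {w : ℕ | ∃ x ∈ C, x ≠ 0 ∧ hammingNorm x = w} d

/-- A monomial matrix: exactly one nonzero entry in each row and in each column. -/
def IsMonomial {n : ℕ} (P : Matrix (Fin n) (Fin n) (ZMod 2)) : Prop :=
  (∀ i, ∃! j, P i j ≠ 0) ∧ (∀ j, ∃! i, P i j ≠ 0)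

/-- Equivalence of codes: `C' = C · P` for some monomial matrix `P`. -/
def Equivalent {n : ℕ} (C C' : BinaryCode n) : Prop :=
  ∃ P : Matrix (Fin n) (Fin n) (ZMod 2), IsMonomial P ∧ C' = C.map P.vecMulLinear

theorem isMonomial_one {n : ℕ} : IsMonomial (1 : Matrix (Fin n) (Fin n) (ZMod 2)) := by
  constructor
  · intro i
    exact ⟨i, by simp, fun j hj => by
      by_contra h
      exact hj (Matrix.one_apply_ne (Ne.symm h))⟩
  · intro j
    exact ⟨j, by simp, fun i hi => by
      by_contra h
      exact hi (Matrix.one_apply_ne h)⟩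

theorem IsMonomial.transpose {n : ℕ} {P : Matrix (Fin n) (Fin n) (ZMod 2)} (hP : IsMonomial P) :
    IsMonomial Pᵀ := ⟨hP.2, hP.1⟩

/-- Over the field with two elements a monomial matrix is a permutation matrix. -/
theorem IsMonomial.exists_perm {n : ℕ} {P : Matrix (Fin n) (Fin n) (ZMod 2)}
    (hP : IsMonomial P) : ∃ σ : Equiv.Perm (Fin n), ∀ i j, P i j = if σ i = j then 1 else 0 := by
  have h01 : ∀ a : ZMod 2, a ≠ 0 → a = 1 := by decide
  choose f hf hfu using hP.1
  choose g hg hgu using hP.2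
  refine ⟨⟨f, g, fun i => (hgu _ _ (hf i)).symm, fun j => (hfu _ _ (hg j)).symm⟩, ?_⟩
  intro i j
  change P i j = if f i = j then 1 else 0
  split_ifs with h
  · subst h
    exact h01 _ (hf i)
  · by_contra hne
    exact h (hfu _ _ hne).symm

theorem isMonomial_of_perm {n : ℕ} {P : Matrix (Fin n) (Fin n) (ZMod 2)}
    (σ : Equiv.Perm (Fin n)) (h : ∀ i j, P i j = if σ i = j then 1 else 0) : IsMonomial P := by
  constructor
  · intro i
    exact ⟨σ i, by simp [h], fun j hj => by
      by_contra hne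
      exact hj (by simp [h, Ne.symm hne])⟩
  · intro j
    refine ⟨σ.symm j, by simp [h], fun i hi => ?_⟩
    by_contra hne
    refine hi ?_
    rw [h, if_neg]
    rintro rfl
    simp at hne

theorem IsMonomial.mul {n : ℕ} {P Q : Matrix (Fin n) (Fin n) (ZMod 2)}
    (hP : IsMonomial P) (hQ : IsMonomial Q) : IsMonomial (P * Q) := by
  obtain ⟨σ, hσ⟩ := hP.exists_perm
  obtain ⟨τ, hτ⟩ := hQ.exists_perm
  refine isMonomial_of_perm (σ.trans τ) fun i j => ?_
  rw [Matrix.mul_apply, Finset.sum_eq_single (σ i)]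
  · rw [hσ, hτ, if_pos rfl, one_mul]
    rfl
  · intro x _ hx
    simp [hσ, Ne.symm hx]
  · simp

theorem IsMonomial.mul_transpose {n : ℕ} {P : Matrix (Fin n) (Fin n) (ZMod 2)}
    (hP : IsMonomial P) : P * Pᵀ = 1 := by
  obtain ⟨σ, hσ⟩ := hP.exists_perm
  ext i j
  simp [Matrix.mul_apply, hσ, Matrix.one_apply, eq_comm]

theorem map_vecMul_mul {n : ℕ} (C : BinaryCode n) (P Q : Matrix (Fin n) (Fin n) (ZMod 2)) :
    (C.map P.vecMulLinear).map Q.vecMulLinear = C.map (P * Q).vecMulLinear := by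
  rw [← Submodule.map_comp]
  congr 1
  refine LinearMap.ext fun x => ?_
  exact Matrix.vecMul_vecMul x P Q

theorem map_vecMul_one {n : ℕ} (C : BinaryCode n) :
    C.map (1 : Matrix (Fin n) (Fin n) (ZMod 2)).vecMulLinear = C := by
  ext x
  simp

theorem equivalent_equivalence (n : ℕ) : Equivalence (@Equivalent n) where
  refl C := ⟨1, isMonomial_one, (map_vecMul_one C).symm⟩
  symm := by
    rintro C _ ⟨P, hP, rfl⟩
    exact ⟨Pᵀ, hP.transpose, by rw [map_vecMul_mul, hP.mul_transpose, map_vecMul_one]⟩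
  trans := by
    rintro C _ _ ⟨P, hP, rfl⟩ ⟨Q, hQ, rfl⟩
    exact ⟨P * Q, hP.mul hQ, map_vecMul_mul C P Q⟩

end BinaryCode

/-- The LCD `[n, k, d]` codes: length `n`, dimension `k`, minimum weight (exactly) `d`. -/
def LCDCode (n k d : ℕ) : Type :=
  {C : BinaryCode n // Module.finrank (ZMod 2) C = k ∧ C.HasMinWeight d ∧ C.IsLCD}

/-- Equivalence of codes, restricted to the LCD `[n, k, d]` codes. -/
instance LCDCode.setoid (n k d : ℕ) : Setoid (LCDCode n k d) :=
  Setoid.comap Subtype.val ⟨BinaryCode.Equivalent, BinaryCode.equivalent_equivalence n⟩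

/-- `N(n, k, d)`: the number of inequivalent LCD `[n, k, d]` codes. -/
noncomputable def numLCD (n k d : ℕ) : ℕ := Nat.card (Quotient (LCDCode.setoid n k d))

/-- A `k`-cover of the `m`-set `Fin m`: a sequence of `k` not necessarily distinct (possibly
empty) subsets whose union is the whole set. -/
def KCover (m k : ℕ) : Type :=
  {Y : Fin k → Finset (Fin m) // ∀ x : Fin m, ∃ i : Fin k, x ∈ Y i}

/-- Two `k`-covers are identified when one arises from the other by a permutation of the `k` sets
(disordered) and a permutation of the elements of the `m`-set (unlabelled). -/
instance KCover.setoid (m k : ℕ) : Setoid (KCover m k) where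
  r Y Z := ∃ (σ : Equiv.Perm (Fin k)) (τ : Equiv.Perm (Fin m)),
    ∀ i, Z.1 i = (Y.1 (σ i)).map τ.toEmbedding
  iseqv :=
    { refl := fun Y => ⟨Equiv.refl _, Equiv.refl _, fun i => by ext x; simp⟩
      symm := by
        rintro Y Z ⟨σ, τ, h⟩
        refine ⟨σ.symm, τ.symm, fun i => ?_⟩
        ext x
        simp [h]
      trans := by
        rintro Y Z W ⟨σ, τ, h⟩ ⟨σ', τ', h'⟩
        refine ⟨σ'.trans σ, τ.trans τ', fun i => ?_⟩
        rw [h' i, h (σ' i), Finset.map_map]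
        rfl }

/-- `T_du(m, k)`: the number of disordered `k`-covers of an unlabelled `m`-set. -/
noncomputable def Tdu (m k : ℕ) : ℕ := Nat.card (Quotient (KCover.setoid m k))

/-! Here the codes have codimension 3. The dot product is nondegenerate on the dual of an LCD code,
and in dimension 3 such a form over 𝔽₂ has an orthonormal basis. So the code is the kernel of an `n
× 3` matrix `G` with `Gᵀ * G = 1`, unique up to an orthogonal `3 × 3` matrix, that is, a permutation
of columns. Classes of codes are thus multisets of rows modulo S₃ (`equivalent_ofCheck_iff`).
Minimum weight 2 excludes the zero row. Orthonormality and the absence of zero then fix the parity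
of every row multiplicity (`count_rowMultiset_cast_eq`): the rows are a fixed S₃-stable set `S` plus
a doubled multiset of `m` nonzero vectors. Those vectors form the incidence matrix of a 3-cover, and
`numLCD_eq_Tdu` turns this into a bijection of classes. -/

namespace Matrix

/-! ### Matrices up to row permutation -/

variable {ι κ : Type*} [Fintype ι] {α : Type*}

/-- The multiset of rows of a matrix. -/
def rowMultiset (G : Matrix ι κ α) : Multiset (κ → α) := Finset.univ.val.map G.row

theorem count_rowMultiset [DecidableEq (κ → α)] (G : Matrix ι κ α) (v : κ → α) :
    G.rowMultiset.count v = Nat.card {i // G.row i = v} := by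
  rw [rowMultiset, Multiset.count_map, Nat.card_eq_fintype_card, Fintype.card_subtype,
    Finset.card_def, Finset.filter_val]
  simp only [eq_comm]

theorem card_rowMultiset (G : Matrix ι κ α) : Multiset.card G.rowMultiset = Fintype.card ι := by
  rw [rowMultiset, Multiset.card_map]
  rfl

theorem mem_rowMultiset {G : Matrix ι κ α} {v : κ → α} :
    v ∈ G.rowMultiset ↔ ∃ i, G.row i = v := by
  simp [rowMultiset]

/-- Equal multiplicities give bijections between the fibres of the two row maps; these glue to one
permutation. -/
theorem rowMultiset_eq_iff {G G' : Matrix ι κ α} :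
    G'.rowMultiset = G.rowMultiset ↔ ∃ τ : Equiv.Perm ι, ∀ i, G'.row i = G.row (τ i) := by
  classical
  constructor
  · intro h
    have hcard (v : κ → α) : Nat.card {i // G'.row i = v} = Nat.card {i // G.row i = v} := by
      rw [← count_rowMultiset, ← count_rowMultiset, h]
    let e (v : κ → α) : {i // G'.row i = v} ≃ {i // G.row i = v} :=
      (Finite.card_eq.1 (hcard v)).some
    exact ⟨(Equiv.sigmaFiberEquiv G'.row).symm.trans
      ((Equiv.sigmaCongrRight e).trans (Equiv.sigmaFiberEquiv G.row)),
      fun i => (e (G'.row i) ⟨i, rfl⟩).2.symm⟩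
  · rintro ⟨τ, h⟩
    have : G'.row = G.row ∘ τ := funext h
    rw [rowMultiset, this, ← Multiset.map_map, Multiset.map_univ_val_equiv, rowMultiset]

theorem exists_rowMultiset_eq {m : ℕ} {K : Multiset (κ → α)} (hK : Multiset.card K = m) :
    ∃ H : Matrix (Fin m) κ α, H.rowMultiset = K := by
  subst hK
  induction K using Quotient.inductionOn with
  | h l =>
    refine ⟨of l.get, ?_⟩
    change Finset.univ.val.map l.get = _
    rw [Fin.univ_val_map, List.ofFn_get]
    rfl

theorem exists_perm_perm_iff {G G' : Matrix ι κ α} :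
    (∃ (σ : Equiv.Perm κ) (τ : Equiv.Perm ι), ∀ i a, G' i a = G (τ i) (σ a)) ↔
      ∃ σ : Equiv.Perm κ, G'.rowMultiset = G.rowMultiset.map (· ∘ σ) := by
  refine exists_congr fun σ => ?_
  have : G.rowMultiset.map (· ∘ σ) = (G.submatrix id σ).rowMultiset := by
    rw [rowMultiset, Multiset.map_map]
    rfl
  rw [this, rowMultiset_eq_iff]
  exact exists_congr fun τ => forall_congr' fun i => funext_iff.symm

/-! ### Orthogonality in dimension three over 𝔽₂ -/

/-- An orthogonal `3 × 3` matrix over the field with two elements is a permutation matrix. -/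
theorem exists_perm_of_transpose_mul_self {A : Matrix (Fin 3) (Fin 3) (ZMod 2)}
    (hA : Aᵀ * A = 1) : ∃ σ : Equiv.Perm (Fin 3), ∀ b a, A b a = if b = σ a then 1 else 0 := by
  -- An odd-weight `u` is a unit vector or 111, and 111 is excluded because its product with `v` is
  -- `v ⬝ᵥ v = 1`.
  have key : ∀ u v : Fin 3 → ZMod 2, u ⬝ᵥ u = 1 → v ⬝ᵥ v = 1 → u ⬝ᵥ v = 0 →
      ∃ i, ∀ b, u b = if b = i then 1 else 0 := by decide
  have hdot (a b : Fin 3) : A.col a ⬝ᵥ A.col b = if a = b then 1 else 0 := by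
    have := congrFun (congrFun hA a) b
    rwa [mul_apply', one_apply] at this
  have hcol (a : Fin 3) : ∃ i, ∀ b, A b a = if b = i then 1 else 0 := by
    refine key (A.col a) (A.col (a + 1)) ?_ ?_ ?_
    · rw [hdot, if_pos rfl]
    · rw [hdot, if_pos rfl]
    · rw [hdot, if_neg (by revert a; decide)]
  choose f hf using hcol
  have hinj : Function.Injective f := by
    intro a b hab
    by_contra hne
    have h := hdot a b
    have hcols : A.col a = A.col b := funext fun c => by
      rw [col_apply, col_apply, hf, hf, hab]
    rw [hcols, hdot, if_pos rfl, if_neg hne] at h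
    exact one_ne_zero h
  exact ⟨Equiv.ofBijective f (Finite.injective_iff_bijective.1 hinj), fun b a => hf a b⟩

set_option maxRecDepth 10000 in
/-- A nondegenerate symmetric bilinear form on `𝔽₂³` has an orthonormal basis. -/
theorem IsSymm.exists_mul_mul_transpose_eq_one {M : Matrix (Fin 3) (Fin 3) (ZMod 2)}
    (hM : M.IsSymm) (hd : M.det ≠ 0) :
    ∃ A : Matrix (Fin 3) (Fin 3) (ZMod 2), A * M * Aᵀ = 1 := by
  -- `a`, …, `f` are the entries on and above the diagonal; the three existential vectors are the
  -- rows of `A`.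
  have key : ∀ a b c d e f : ZMod 2,
      a * d * f - a * e * e - b * b * f + b * e * c + c * b * e - c * d * c ≠ 0 →
      ∃ x y z : ZMod 2, (x * a + y * b + z * c) * x + (x * b + y * d + z * e) * y +
          (x * c + y * e + z * f) * z = 1 ∧
      ∃ x' y' z' : ZMod 2, (x' * a + y' * b + z' * c) * x' + (x' * b + y' * d + z' * e) * y' +
          (x' * c + y' * e + z' * f) * z' = 1 ∧
        (x * a + y * b + z * c) * x' + (x * b + y * d + z * e) * y' +
          (x * c + y * e + z * f) * z' = 0 ∧
      ∃ x'' y'' z'' : ZMod 2, (x'' * a + y'' * b + z'' * c) * x'' +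
          (x'' * b + y'' * d + z'' * e) * y'' + (x'' * c + y'' * e + z'' * f) * z'' = 1 ∧
        (x * a + y * b + z * c) * x'' + (x * b + y * d + z * e) * y'' +
          (x * c + y * e + z * f) * z'' = 0 ∧
        (x' * a + y' * b + z' * c) * x'' + (x' * b + y' * d + z' * e) * y'' +
          (x' * c + y' * e + z' * f) * z'' = 0 := by
    decide
  have h10 := hM.apply 0 1
  have h20 := hM.apply 0 2
  have h21 := hM.apply 1 2
  rw [det_fin_three, h10, h20, h21] at hd
  obtain ⟨x, y, z, h1, x', y', z', h2, h3, x'', y'', z'', h4, h5, h6⟩ := key _ _ _ _ _ _ hd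
  refine ⟨!![x, y, z; x', y', z'; x'', y'', z''], ?_⟩
  rw [M.eta_fin_three, h10, h20, h21]
  generalize M 0 0 = a, M 0 1 = b, M 0 2 = c, M 1 1 = d, M 1 2 = e, M 2 2 = f at *
  ext i j
  fin_cases i <;> fin_cases j <;>
    simp [mul_apply, Fin.sum_univ_three] <;>
    first
    | linear_combination h1
    | linear_combination h2
    | linear_combination h3
    | linear_combination h4
    | linear_combination h5
    | linear_combination h6

end Matrix
-- LCD codes as kernels of matrices with orthonormal columns
namespace BinaryCode

variable {n k : ℕ}

/-- The code with parity check matrix `Gᵀ`. -/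
def ofCheck (G : Matrix (Fin n) (Fin k) (ZMod 2)) : BinaryCode n := LinearMap.ker G.vecMulLinear

theorem mem_ofCheck {G : Matrix (Fin n) (Fin k) (ZMod 2)} {x : Fin n → ZMod 2} :
    x ∈ ofCheck G ↔ x ᵥ* G = 0 := Iff.rfl

variable {G : Matrix (Fin n) (Fin k) (ZMod 2)}

/-- `G * Gᵀ` is the orthogonal projection onto the column space of `G`, and the code is its kernel.
-/
theorem sub_vecMul_mem_ofCheck (hG : Gᵀ * G = 1) (x : Fin n → ZMod 2) :
    x - x ᵥ* G ᵥ* Gᵀ ∈ ofCheck G := by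
  rw [mem_ofCheck, Matrix.sub_vecMul, Matrix.vecMul_vecMul _ Gᵀ, hG, Matrix.vecMul_one, sub_self]

theorem finrank_ofCheck (hG : Gᵀ * G = 1) : Module.finrank (ZMod 2) (ofCheck G) + k = n := by
  have hs : LinearMap.range G.vecMulLinear = ⊤ :=
    LinearMap.range_eq_top.2 fun v => ⟨v ᵥ* Gᵀ, by
      rw [Matrix.vecMulLinear_apply, Matrix.vecMul_vecMul, hG, Matrix.vecMul_one]⟩
  have h := G.vecMulLinear.finrank_range_add_finrank_ker
  rw [hs, finrank_top, Module.finrank_fin_fun, Module.finrank_fin_fun] at h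
  rw [add_comm]
  exact h

theorem isLCD_ofCheck (hG : Gᵀ * G = 1) : (ofCheck G).IsLCD := by
  rw [IsLCD, eq_bot_iff]
  rintro x ⟨hx, hxd⟩
  refine dotProduct_eq_zero x fun y => ?_
  have h := hxd _ (sub_vecMul_mem_ofCheck hG y)
  rw [dotProduct_sub, Matrix.vecMul_transpose, Matrix.dotProduct_mulVec, mem_ofCheck.1 hx,
    zero_dotProduct, sub_zero] at h
  exact h

theorem single_vecMul (i : Fin n) (G : Matrix (Fin n) (Fin k) (ZMod 2)) :
    Pi.single i 1 ᵥ* G = G i := by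
  rw [Matrix.single_one_vecMul]
  rfl

theorem hasMinWeight_two_ofCheck (h0 : ∀ i, G i ≠ 0) {i j : Fin n} (hij : i ≠ j)
    (h : G i = G j) : (ofCheck G).HasMinWeight 2 := by
  constructor
  · refine ⟨Pi.single i 1 + Pi.single j 1, ?_, fun hx => ?_, ?_⟩
    · rw [mem_ofCheck, Matrix.add_vecMul, single_vecMul, single_vecMul, h]
      exact funext fun _ => CharTwo.add_self_eq_zero _
    · have := congrFun hx i
      simp [hij] at this
    · have : Finset.univ.filter (fun l => (Pi.single i 1 + Pi.single j 1 : Fin n → ZMod 2) l ≠ 0) =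
          {i, j} := by
        ext l
        by_cases hi : l = i
        · subst hi
          simp [hij]
        · by_cases hj : l = j
          · subst hj
            simp [hi]
          · simp [hi, hj]
      rw [hammingNorm, this, Finset.card_pair hij]
  · rintro w ⟨x, hx, hx0, rfl⟩
    by_contra! hlt
    have hpos := hammingNorm_pos_iff.2 hx0
    have hone : hammingNorm x = 1 := by omega
    obtain ⟨l, hl⟩ := Finset.card_eq_one.1 hone
    have hxl : x = Pi.single l 1 := by
      funext t
      have ht : x t ≠ 0 ↔ t = l := by simpa using Finset.ext_iff.1 hl t
      by_cases htl : t = l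
      · subst htl
        rw [Pi.single_eq_same]
        exact (show ∀ a : ZMod 2, a ≠ 0 → a = 1 by decide) _ (ht.2 rfl)
      · rw [Pi.single_eq_of_ne htl]
        by_contra hne
        exact htl (ht.1 hne)
    rw [hxl, mem_ofCheck, single_vecMul] at hx
    exact h0 l hx

theorem HasMinWeight.row_ne_zero (h : (ofCheck G).HasMinWeight 2) (i : Fin n) : G i ≠ 0 := by
  intro hi
  have h2 : 2 ≤ hammingNorm (Pi.single i 1 : Fin n → ZMod 2) := by
    refine h.2 ⟨Pi.single i 1, ?_, ?_, rfl⟩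
    · rw [mem_ofCheck, single_vecMul, hi]
    · simp
  have h1 : hammingNorm (Pi.single i 1 : Fin n → ZMod 2) ≤ 1 := by
    refine (Finset.card_le_card (t := {i}) fun l hl => ?_).trans (Finset.card_singleton i).le
    by_contra hne
    rw [Finset.mem_singleton] at hne
    simp [hne] at hl
  omega

theorem finrank_dual (C : BinaryCode n) :
    Module.finrank (ZMod 2) C.dual = n - Module.finrank (ZMod 2) C := by
  have hB : (dotProductBilin (ZMod 2) (ZMod 2) :
      LinearMap.BilinForm (ZMod 2) (Fin n → ZMod 2)).Nondegenerate :=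
    ⟨fun x hx => dotProduct_eq_zero x hx,
      fun x hx => dotProduct_eq_zero x fun y => by rw [dotProduct_comm]; exact hx y⟩
  have h := LinearMap.BilinForm.finrank_orthogonal hB C
  rw [Module.finrank_fin_fun] at h
  have hC : C.dual = LinearMap.BilinForm.orthogonal (dotProductBilin (ZMod 2) (ZMod 2)) C := by
    ext x
    exact forall₂_congr fun y _ => by rw [dotProduct_comm]; rfl
  rw [← h, hC]

theorem IsLCD.sup_dual {C : BinaryCode n} (hC : C.IsLCD) : C ⊔ C.dual = ⊤ := by
  apply Submodule.eq_top_of_finrank_eq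
  have h := Submodule.finrank_sup_add_finrank_inf_eq C C.dual
  have hle := C.finrank_le
  rw [hC, finrank_bot, finrank_dual] at h
  rw [Module.finrank_fin_fun] at hle ⊢
  omega

/-- The Gram matrix of a basis of the dual is nonsingular, since a radical vector would be
orthogonal to `C ⊔ C.dual = ⊤`; so the basis can be made orthonormal. -/
theorem IsLCD.exists_ofCheck {C : BinaryCode n} (hC : C.IsLCD)
    (hk : Module.finrank (ZMod 2) C + 3 = n) :
    ∃ G : Matrix (Fin n) (Fin 3) (ZMod 2), Gᵀ * G = 1 ∧ C = ofCheck G := by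
  have hd : Module.finrank (ZMod 2) C.dual = 3 := by rw [finrank_dual]; omega
  let b : Module.Basis (Fin 3) (ZMod 2) C.dual := Module.finBasisOfFinrankEq _ _ hd
  let B : Matrix (Fin n) (Fin 3) (ZMod 2) := Matrix.of fun i a => (b a : Fin n → ZMod 2) i
  have hmulVec (v : Fin 3 → ZMod 2) : B *ᵥ v = ((∑ a, v a • b a : C.dual) : Fin n → ZMod 2) := by
    funext i
    simp [B, Matrix.mulVec, dotProduct, mul_comm]
  have hmem (v : Fin 3 → ZMod 2) : B *ᵥ v ∈ C.dual := by
    rw [hmulVec]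
    exact Subtype.prop _
  have hdet : (Bᵀ * B).det ≠ 0 := by
    intro h0
    obtain ⟨v, hv, hv0⟩ := Matrix.exists_mulVec_eq_zero_iff.2 h0
    refine hv ?_
    have horth (w : Fin 3 → ZMod 2) : B *ᵥ v ⬝ᵥ B *ᵥ w = 0 := by
      rw [Matrix.dotProduct_mulVec, ← Matrix.mulVec_transpose, Matrix.mulVec_mulVec, hv0,
        zero_dotProduct]
    have hz : B *ᵥ v = 0 := by
      refine dotProduct_eq_zero _ fun y => ?_
      have hy : y ∈ C ⊔ C.dual := by rw [hC.sup_dual]; trivial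
      obtain ⟨c, hc, d, hd, rfl⟩ := Submodule.mem_sup.1 hy
      have hdB : d = B *ᵥ (b.repr ⟨d, hd⟩) := by
        rw [hmulVec, b.sum_repr]
      rw [dotProduct_add, hmem v c hc, hdB, horth, add_zero]
    rw [hmulVec, ZeroMemClass.coe_eq_zero] at hz
    funext a
    exact Fintype.linearIndependent_iff.1 b.linearIndependent v hz a
  have hsymm : (Bᵀ * B).IsSymm := by
    rw [Matrix.IsSymm, Matrix.transpose_mul, Matrix.transpose_transpose]
  obtain ⟨A, hA⟩ := hsymm.exists_mul_mul_transpose_eq_one hdet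
  have hG : (B * Aᵀ)ᵀ * (B * Aᵀ) = 1 := by
    rw [← hA, Matrix.transpose_mul, Matrix.transpose_transpose]
    simp only [Matrix.mul_assoc]
  refine ⟨B * Aᵀ, hG, Submodule.eq_of_le_of_finrank_eq (fun x hx => ?_) ?_⟩
  · rw [mem_ofCheck]
    refine dotProduct_eq_zero _ fun w => ?_
    rw [← Matrix.dotProduct_mulVec, ← Matrix.mulVec_mulVec, dotProduct_comm]
    exact hmem _ x hx
  · have := finrank_ofCheck hG
    omega

theorem map_ofCheck_of_perm {P : Matrix (Fin n) (Fin n) (ZMod 2)} {σ : Equiv.Perm (Fin n)}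
    (h : ∀ i j, P i j = if σ i = j then 1 else 0) :
    (ofCheck G).map P.vecMulLinear = ofCheck (G.submatrix σ.symm id) := by
  have hP (x : Fin n → ZMod 2) : x ᵥ* P = x ∘ σ.symm := by
    funext j
    rw [Matrix.vecMul, dotProduct, Finset.sum_eq_single (σ.symm j)]
    · simp [h]
    · intro i _ hi
      rw [h, if_neg (fun hij => hi (by rw [← hij, Equiv.symm_apply_apply])), mul_zero]
    · simp
  have hG (x : Fin n → ZMod 2) : (x ∘ σ.symm) ᵥ* G.submatrix σ.symm id = x ᵥ* G := by
    funext a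
    exact Equiv.sum_comp σ.symm fun i => x i * G i a
  ext y
  constructor
  · rintro ⟨x, hx, rfl⟩
    rw [Matrix.vecMulLinear_apply, hP, mem_ofCheck, hG]
    exact hx
  · intro hy
    refine ⟨y ∘ σ, ?_, ?_⟩
    · change y ∘ σ ∈ ofCheck G
      rw [mem_ofCheck, ← hG, Function.comp_assoc, Equiv.self_comp_symm]
      exact hy
    · rw [Matrix.vecMulLinear_apply, hP, Function.comp_assoc, Equiv.self_comp_symm]
      rfl

theorem equivalent_ofCheck_iff {G G' : Matrix (Fin n) (Fin 3) (ZMod 2)} (hG : Gᵀ * G = 1)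
    (hG' : G'ᵀ * G' = 1) : Equivalent (ofCheck G) (ofCheck G') ↔
      ∃ (σ : Equiv.Perm (Fin 3)) (τ : Equiv.Perm (Fin n)), ∀ i a, G' i a = G (τ i) (σ a) := by
  constructor
  · rintro ⟨P, hP, hC⟩
    obtain ⟨τ, hτ⟩ := hP.exists_perm
    rw [map_ofCheck_of_perm hτ] at hC
    set H := G.submatrix τ.symm id with hHdef
    have hH : Hᵀ * H = 1 := by
      rw [hHdef, Matrix.transpose_submatrix, Matrix.submatrix_mul_equiv, hG, Matrix.submatrix_id_id]
    -- Each unit vector minus its projection lies in the common kernel, so `G'` kills it.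
    have hHA : G' = H * (Hᵀ * G') := by
      refine Matrix.ext_of_single_vecMul fun i => ?_
      have h := sub_vecMul_mem_ofCheck hH (Pi.single i 1)
      rw [← hC, mem_ofCheck, Matrix.sub_vecMul, sub_eq_zero] at h
      rw [h, Matrix.vecMul_vecMul, Matrix.vecMul_vecMul]
    have hA : (Hᵀ * G')ᵀ * (Hᵀ * G') = 1 := by
      conv_rhs => rw [← hG', hHA]
      rw [Matrix.transpose_mul H, Matrix.mul_assoc, ← Matrix.mul_assoc Hᵀ H, hH, Matrix.one_mul]
    obtain ⟨σ, hσ⟩ := Matrix.exists_perm_of_transpose_mul_self hA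
    refine ⟨σ, τ.symm, fun i a => ?_⟩
    rw [hHA, Matrix.mul_apply, Finset.sum_eq_single (σ a)]
    · rw [hσ, if_pos rfl, mul_one]
      rfl
    · intro c _ hc
      rw [hσ, if_neg hc, mul_zero]
    · simp
  · rintro ⟨σ, τ, h⟩
    refine ⟨fun i j => if τ.symm i = j then 1 else 0, isMonomial_of_perm τ.symm fun _ _ => rfl, ?_⟩
    rw [map_ofCheck_of_perm (σ := τ.symm) fun _ _ => rfl]
    ext x
    have hx (a : Fin 3) : (x ᵥ* G') a = (x ᵥ* G.submatrix τ id) (σ a) := by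
      simp only [Matrix.vecMul, dotProduct, h]
      rfl
    rw [Equiv.symm_symm, mem_ofCheck, mem_ofCheck, funext_iff, funext_iff]
    exact (forall_congr' fun a => by rw [hx]; rfl).trans
      (σ.forall_congr_right (q := fun b => (x ᵥ* G.submatrix τ id) b = 0))

end BinaryCode

/-! ### Parities of row multiplicities and doubled rows -/

namespace Matrix

variable {ι κ : Type*} [Fintype ι]

/-- The polynomial expansion over the field with two elements of the indicator of a row. -/
theorem ite_row_eq (v w : Fin 3 → ZMod 2) : (if v = w then 1 else 0 : ZMod 2) =
    (1 + w 0) * (1 + w 1) * (1 + w 2) + (1 + w 0) * (1 + w 1) * (v 2 * v 2) +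
      (1 + w 0) * (1 + w 2) * (v 1 * v 1) + (1 + w 1) * (1 + w 2) * (v 0 * v 0) +
      (1 + w 0) * (v 1 * v 2) + (1 + w 1) * (v 0 * v 2) + (1 + w 2) * (v 0 * v 1) +
      v 0 * v 1 * v 2 := by
  revert v w
  decide

theorem sum_mul_of_transpose_mul_self {G : Matrix ι (Fin 3) (ZMod 2)} (hG : Gᵀ * G = 1)
    (a b : Fin 3) : ∑ i, G i a * G i b = if a = b then 1 else 0 := by
  rw [← one_apply, ← hG, mul_apply]
  rfl

/-- The parity of the multiplicity of a row of a matrix with orthonormal columns, up to a term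
independent of the row. -/
theorem count_rowMultiset_cast {G : Matrix ι (Fin 3) (ZMod 2)} (hG : Gᵀ * G = 1)
    (w : Fin 3 → ZMod 2) : (G.rowMultiset.count w : ZMod 2) =
      Fintype.card ι * ((1 + w 0) * (1 + w 1) * (1 + w 2)) + (1 + w 0) * (1 + w 1) +
        (1 + w 0) * (1 + w 2) + (1 + w 1) * (1 + w 2) + ∑ i, G i 0 * G i 1 * G i 2 := by
  have h : (G.rowMultiset.count w : ZMod 2) = ∑ i, if G i = w then 1 else 0 := by
    rw [count_rowMultiset, Nat.card_eq_fintype_card, Fintype.card_subtype, Finset.sum_boole]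
    rfl
  rw [h]
  -- Orthonormality evaluates every quadratic sum, squares included; only the triple product stays
  -- unknown.
  simp only [ite_row_eq, Finset.sum_add_distrib, ← Finset.mul_sum, sum_mul_of_transpose_mul_self hG]
  simp
  ring

/-- The unknown triple sum is determined by taking `w = 0`, where both multiplicities vanish. -/
theorem count_rowMultiset_cast_eq [Fintype κ] {G : Matrix ι (Fin 3) (ZMod 2)} {S : Matrix κ (Fin 3) (ZMod 2)}
    (hG : Gᵀ * G = 1) (hS : Sᵀ * S = 1) (hG0 : ∀ i, G i ≠ 0) (hS0 : ∀ i, S i ≠ 0)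
    (hcard : (Fintype.card ι : ZMod 2) = Fintype.card κ) (w : Fin 3 → ZMod 2) :
    (G.rowMultiset.count w : ZMod 2) = S.rowMultiset.count w := by
  have hzG : G.rowMultiset.count 0 = 0 := Multiset.count_eq_zero.2 fun h => by
    obtain ⟨i, hi⟩ := mem_rowMultiset.1 h
    exact hG0 i hi
  have hzS : S.rowMultiset.count 0 = 0 := Multiset.count_eq_zero.2 fun h => by
    obtain ⟨i, hi⟩ := mem_rowMultiset.1 h
    exact hS0 i hi
  have h1 := count_rowMultiset_cast hG 0
  have h2 := count_rowMultiset_cast hS 0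
  rw [hzG] at h1
  rw [hzS, ← hcard] at h2
  rw [count_rowMultiset_cast hG, count_rowMultiset_cast hS, hcard]
  linear_combination h2 - h1

/-- If the rows of `S` are distinct, any matrix whose rows have the same parities of multiplicities
consists of the rows of `S` and of a doubled family of rows. -/
theorem exists_rowMultiset_eq_add {m r n : ℕ} (hn : n = 2 * m + r)
    {G : Matrix (Fin n) (Fin 3) (ZMod 2)} {S : Matrix (Fin r) (Fin 3) (ZMod 2)}
    (hinj : Function.Injective S.row)
    (hpar : ∀ w, (G.rowMultiset.count w : ZMod 2) = S.rowMultiset.count w) :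
    ∃ H : Matrix (Fin m) (Fin 3) (ZMod 2),
      G.rowMultiset = 2 • H.rowMultiset + S.rowMultiset := by
  have hmod (w) : G.rowMultiset.count w % 2 = S.rowMultiset.count w % 2 :=
    (ZMod.natCast_eq_natCast_iff' _ _ 2).1 (hpar w)
  have hS1 (w) : S.rowMultiset.count w ≤ 1 :=
    Multiset.nodup_iff_count_le_one.1 (Finset.univ.nodup.map hinj) w
  have hle : S.rowMultiset ≤ G.rowMultiset := Multiset.le_iff_count.2 fun w => by
    have := hmod w
    have := hS1 w
    omega
  obtain ⟨K, hK⟩ := Multiset.exists_smul_of_dvd_count (G.rowMultiset - S.rowMultiset) (k := 2)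
    fun w _ => by
      rw [Multiset.count_sub]
      have := hmod w
      have := hS1 w
      omega
  have hcard := congrArg Multiset.card (tsub_add_cancel_of_le hle)
  rw [hK, Multiset.card_add, Multiset.card_nsmul, card_rowMultiset, card_rowMultiset,
    Fintype.card_fin, Fintype.card_fin] at hcard
  obtain ⟨H, hH⟩ := exists_rowMultiset_eq (m := m) (K := K) (by omega)
  exact ⟨H, by rw [hH, ← hK, tsub_add_cancel_of_le hle]⟩

/-- The matrix consisting of two copies of `H` above `S`. -/
noncomputable def doubleAppend {m r : ℕ} {α : Type*} (H : Matrix (Fin m) κ α)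
    (S : Matrix (Fin r) κ α) : Matrix (Fin (2 * m + r)) κ α :=
  (fromRows (fromRows H H) S).submatrix
    (Fintype.equivOfCardEq (by simp [two_mul]) : Fin (2 * m + r) ≃ (Fin m ⊕ Fin m) ⊕ Fin r) id

theorem exists_equiv_doubleAppend {m r : ℕ} {α : Type*} (H : Matrix (Fin m) κ α)
    (S : Matrix (Fin r) κ α) : ∃ e : Fin (2 * m + r) ≃ (Fin m ⊕ Fin m) ⊕ Fin r,
      H.doubleAppend S = (fromRows (fromRows H H) S).submatrix e id := ⟨_, rfl⟩

theorem rowMultiset_submatrix_equiv {ι' α : Type*} [Fintype ι'] (G : Matrix ι κ α) (e : ι' ≃ ι) :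
    (G.submatrix e id).rowMultiset = G.rowMultiset := by
  have : (G.submatrix e id).row = G.row ∘ e := rfl
  rw [rowMultiset, this, ← Multiset.map_map, Multiset.map_univ_val_equiv, rowMultiset]

theorem rowMultiset_fromRows {ι' α : Type*} [Fintype ι'] (G : Matrix ι κ α) (H : Matrix ι' κ α) :
    (fromRows G H).rowMultiset = G.rowMultiset + H.rowMultiset := by
  simp only [rowMultiset]
  rw [← Finset.univ_disjSum_univ, Finset.val_disjSum, Multiset.disjSum, Multiset.map_add,
    Multiset.map_map, Multiset.map_map]
  rfl

theorem rowMultiset_doubleAppend {m r : ℕ} {α : Type*} (H : Matrix (Fin m) κ α)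
    (S : Matrix (Fin r) κ α) :
    (H.doubleAppend S).rowMultiset = 2 • H.rowMultiset + S.rowMultiset := by
  rw [doubleAppend, rowMultiset_submatrix_equiv, rowMultiset_fromRows, rowMultiset_fromRows,
    two_nsmul]

theorem transpose_mul_self_doubleAppend {m r : ℕ} [DecidableEq κ] (H : Matrix (Fin m) κ (ZMod 2))
    {S : Matrix (Fin r) κ (ZMod 2)} (hS : Sᵀ * S = 1) :
    (H.doubleAppend S)ᵀ * H.doubleAppend S = 1 := by
  obtain ⟨e, he⟩ := exists_equiv_doubleAppend H S
  rw [he, transpose_submatrix, submatrix_mul_equiv, submatrix_id_id]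
  simp only [transpose_fromRows, fromCols_mul_fromRows]
  have h (M : Matrix κ κ (ZMod 2)) : M + M = 0 := by
    ext
    exact CharTwo.add_self_eq_zero _
  rw [h, hS, zero_add]

theorem doubleAppend_row_ne_zero {m r : ℕ} {H : Matrix (Fin m) κ (ZMod 2)}
    {S : Matrix (Fin r) κ (ZMod 2)} (hH : ∀ i, H i ≠ 0) (hS : ∀ i, S i ≠ 0) (i) :
    H.doubleAppend S i ≠ 0 := by
  obtain ⟨e, he⟩ := exists_equiv_doubleAppend H S
  rw [he]
  change fromRows (fromRows H H) S (e i) ≠ 0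
  rcases e i with (x | x) | x
  exacts [hH x, hH x, hS x]

theorem exists_ne_doubleAppend_eq {m r : ℕ} (hm : 1 ≤ m) (H : Matrix (Fin m) κ (ZMod 2))
    (S : Matrix (Fin r) κ (ZMod 2)) :
    ∃ i j, i ≠ j ∧ H.doubleAppend S i = H.doubleAppend S j := by
  obtain ⟨e, he⟩ := exists_equiv_doubleAppend H S
  refine ⟨e.symm (.inl (.inl ⟨0, hm⟩)), e.symm (.inl (.inr ⟨0, hm⟩)), by simp, ?_⟩
  rw [he]
  funext a
  simp

end Matrix

/-! ### Covers as matrices without zero rows -/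

namespace KCover

variable {m k : ℕ}

/-- The incidence matrix of a cover. -/
def incidence (Y : KCover m k) : Matrix (Fin m) (Fin k) (ZMod 2) :=
  Matrix.of fun x i => if x ∈ Y.1 i then 1 else 0

theorem incidence_row_ne_zero (Y : KCover m k) (x : Fin m) : Y.incidence x ≠ 0 := by
  intro h
  obtain ⟨i, hi⟩ := Y.2 x
  have := congrFun h i
  simp [incidence, hi] at this

theorem exists_incidence_eq {H : Matrix (Fin m) (Fin k) (ZMod 2)} (hH : ∀ x, H x ≠ 0) :
    ∃ Y : KCover m k, Y.incidence = H := by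
  have h2 : ∀ a : ZMod 2, a ≠ 0 → a = 1 := by decide
  refine ⟨⟨fun i => Finset.univ.filter fun x => H x i = 1, fun x => ?_⟩, ?_⟩
  · obtain ⟨i, hi⟩ := Function.ne_iff.1 (hH x)
    exact ⟨i, by simpa using h2 _ hi⟩
  · ext x i
    by_cases h : H x i = 1
    · simp [incidence, h]
    · have h0 : H x i = 0 := by
        by_contra hne
        exact h (h2 _ hne)
      simp [incidence, h0]

theorem setoid_iff {Y Z : KCover m k} : KCover.setoid m k Y Z ↔
    ∃ (σ : Equiv.Perm (Fin k)) (τ : Equiv.Perm (Fin m)),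
      ∀ x i, Z.incidence x i = Y.incidence (τ x) (σ i) := by
  have hmem (Y : KCover m k) (x i) : Y.incidence x i = 1 ↔ x ∈ Y.1 i := by simp [incidence]
  constructor
  · rintro ⟨σ, τ, h⟩
    refine ⟨σ, τ.symm, fun x i => ?_⟩
    have : x ∈ Z.1 i ↔ τ.symm x ∈ Y.1 (σ i) := by rw [h, Finset.mem_map_equiv]
    simp only [incidence, Matrix.of_apply, this]
  · rintro ⟨σ, τ, h⟩
    refine ⟨σ, τ.symm, fun i => ?_⟩
    ext x
    rw [Finset.mem_map_equiv, Equiv.symm_symm, ← hmem, ← hmem, h]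

end KCover

/-! ### The bijection between classes of covers and classes of codes -/

/-- Covers by three sets classify the LCD codes of codimension three and minimum weight two, given
a set of nonzero vectors of `𝔽₂³` which is stable under permutations of the coordinates and whose
matrix has orthonormal columns. -/
theorem numLCD_eq_Tdu {m r k : ℕ} (hm : 1 ≤ m) (hk : k + 3 = 2 * m + r)
    (S : Matrix (Fin r) (Fin 3) (ZMod 2)) (hS : Sᵀ * S = 1) (hS0 : ∀ i, S.row i ≠ 0)
    (hinj : Function.Injective S.row)
    (hperm : ∀ σ : Equiv.Perm (Fin 3), S.rowMultiset.map (· ∘ σ) = S.rowMultiset) :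
    numLCD (2 * m + r) k 2 = Tdu m 3 := by
  let Φ (Y : KCover m 3) : LCDCode (2 * m + r) k 2 :=
    ⟨BinaryCode.ofCheck (Y.incidence.doubleAppend S), by
      have hG := Matrix.transpose_mul_self_doubleAppend Y.incidence hS
      refine ⟨by have := BinaryCode.finrank_ofCheck hG; omega, ?_, BinaryCode.isLCD_ofCheck hG⟩
      obtain ⟨i, j, hij, h⟩ := Matrix.exists_ne_doubleAppend_eq hm Y.incidence S
      exact BinaryCode.hasMinWeight_two_ofCheck
        (Matrix.doubleAppend_row_ne_zero Y.incidence_row_ne_zero hS0) hij h⟩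
  have hΦ (Y Z : KCover m 3) : KCover.setoid m 3 Y Z ↔ LCDCode.setoid (2 * m + r) k 2 (Φ Y) (Φ Z) := by
    have h2 : LCDCode.setoid (2 * m + r) k 2 (Φ Y) (Φ Z) ↔ BinaryCode.Equivalent
      (BinaryCode.ofCheck (Y.incidence.doubleAppend S))
      (BinaryCode.ofCheck (Z.incidence.doubleAppend S)) := Iff.rfl
    rw [h2, BinaryCode.equivalent_ofCheck_iff (Matrix.transpose_mul_self_doubleAppend _ hS)
      (Matrix.transpose_mul_self_doubleAppend _ hS), KCover.setoid_iff,
      Matrix.exists_perm_perm_iff, Matrix.exists_perm_perm_iff]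
    refine exists_congr fun σ => ?_
    -- Since `S` is stable under `σ` it cancels, and the doubled multisets can be halved.
    rw [Matrix.rowMultiset_doubleAppend, Matrix.rowMultiset_doubleAppend, Multiset.map_add, hperm,
      Multiset.map_nsmul, add_left_inj]
    refine ⟨fun h => by rw [h], fun h => ?_⟩
    ext v
    have := congrArg (Multiset.count v) h
    rw [Multiset.count_nsmul, Multiset.count_nsmul] at this
    omega
  refine (Nat.card_congr (Equiv.ofBijective
    (Quotient.map Φ fun Y Z h => (hΦ Y Z).1 h) ⟨?_, ?_⟩)).symm
  · rintro ⟨Y⟩ ⟨Z⟩ h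
    exact Quotient.sound ((hΦ Y Z).2 (Quotient.exact h))
  · rintro ⟨C, hCk, hCw, hC⟩
    obtain ⟨G, hG, rfl⟩ := hC.exists_ofCheck (by omega)
    have hcard : (Fintype.card (Fin (2 * m + r)) : ZMod 2) = Fintype.card (Fin r) := by
      have : (2 : ZMod 2) = 0 := rfl
      simp [this]
    obtain ⟨H, hH⟩ := Matrix.exists_rowMultiset_eq_add rfl hinj
      (Matrix.count_rowMultiset_cast_eq hG hS hCw.row_ne_zero hS0 hcard)
    have hH0 (x) : H x ≠ 0 := by
      have hx : H.row x ∈ G.rowMultiset := by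
        rw [hH, two_nsmul]
        exact Multiset.mem_add.2 (.inl (Multiset.mem_add.2
          (.inl (Matrix.mem_rowMultiset.2 ⟨x, rfl⟩))))
      obtain ⟨i, hi⟩ := Matrix.mem_rowMultiset.1 hx
      intro h
      exact hCw.row_ne_zero i (hi.trans h)
    obtain ⟨Y, rfl⟩ := KCover.exists_incidence_eq hH0
    refine ⟨Quotient.mk _ Y, Quotient.sound ?_⟩
    refine (BinaryCode.equivalent_ofCheck_iff
      (Matrix.transpose_mul_self_doubleAppend _ hS) hG).2 ?_
    rw [Matrix.exists_perm_perm_iff]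
    refine ⟨1, ?_⟩
    rw [hH, Matrix.rowMultiset_doubleAppend]
    exact (Multiset.map_id _).symm

theorem mainTheorem11 (m : ℕ) (hm : 1 ≤ m) (hm' : m ≤ 11) :
    numLCD (2 * m + 3) (2 * m) 2 = numLCD (2 * m + 4) (2 * m + 1) 2 ∧
      numLCD (2 * m + 4) (2 * m + 1) 2 = Tdu m 3 := by
  -- The parity formula forces `S`: for odd length the rows of odd multiplicity are the vectors of
  -- weight 1, for even length those of weight 2 or 3.
  have h3 : numLCD (2 * m + 3) (2 * m) 2 = Tdu m 3 :=
    numLCD_eq_Tdu hm rfl !![1, 0, 0; 0, 1, 0; 0, 0, 1] (by decide) (by decide) (by decide)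
      (by decide)
  have h4 : numLCD (2 * m + 4) (2 * m + 1) 2 = Tdu m 3 :=
    numLCD_eq_Tdu hm rfl !![1, 1, 0; 1, 0, 1; 0, 1, 1; 1, 1, 1] (by decide) (by decide) (by decide)
      (by decide)
  exact ⟨h3.trans h4.symm, h4⟩
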